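/- Let $d\in\mathbb N$ and let $F$ be the law of a random vector in $\mathbb R^d$ with continuous marginal distribution functions $F_1,\dots,F_d$ and copula $C$, i.e. $C(\mathbf u)=\mathbb P\{F_1(X_1)\le u_1,\dots,F_d(X_d)\le u_d\}$ for $(X_1,\dots,X_d)\sim F$ and $\mathbf u\in[0,1]^d$. Let $\mathbf X_1,\mathbf X_2,\dots$ be random vectors on one probability space, each with law $F$ (independence is not required). Let $\mathbb F_{nj}(t)=\frac1n\sum_{i=1}^n \mathbf 1\{X_{ij}\le t\}$, and let $$\bar{\mathbb C}_n(\mathbf u)=\frac1n\sum_{i=1}^n \mathbf 1\{\mathbb F_{n1}(X_{i1})\le u_1,\dots,\mathbb F_{nd}(X_{id})\le u_d\},\qquad \mathbf u\in[0,1]^d.$$ For functions $g:[0,1]^d\to\mathbb R$ put $$\bar{\mathbb Z}_n(g)=\sqrt n\int g\,d(\bar{\mathbb C}_n-C)=\frac1{\sqrt n}\sum_{i=1}^n\bigl\{g(\mathbb F_{n1}(X_{i1}),\dots,\mathbb F_{nd}(X_{id}))-\mathbb E[g(F_1(X_{i1}),\dots,F_d(X_{id}))]\bigr\}.$$ Let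 $V_{\rm HK}(g)=\sum_{I\subset\{1,\dots,d\}}V(g(\cdot\,;\mathbf 1_{-I}))$ be the Hardy--Krause variation. Here $g(\cdot\,;\mathbf 1_{-I})$ is the function on $[0,1]^I$ obtained from $g$ by setting the coordinates outside $I$ equal to $1$, $V$ is the total variation in the sense of Vitali (the supremum, over all finite grids of $[0,1]^I$, of the sum of the absolute generalized volumes of the cells), and the term for $I=\emptyset$ is $|g(\mathbf 1)|$. For a set $S$, weak convergence in $\ell^\infty(S)$ (the bounded real functions on $S$ with the supremum norm) means that $\mathbb E^*h(\mathbb X_n)\to\mathbb E\,h(\mathbb X)$ for all bounded continuous $h:\ell^\infty(S)\to\mathbb R$, where $\mathbb E^*$ is outer expectation and $\mathbb X$ is a Borel random element of $\ell^\infty(S)$. The limit $\mathbb X$ is Gaussian if all its finite-dimensional marginals are (possibly degenerate) normal. **Theorem.** Assume that $\sqrt n(\bar{\mathbb C}_n-C)$ converges weakly in $\ell^\infty([0,1]^d)$ to a Gaussian process with almost surely continuous sample paths. Let $T<\infty$, and let $\mathcal G$ be any class of functions $g:[0,1]^d\to\mathbb R$ that are right-continuous in each coordinate at every point and satisfy $V_{\rm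 HK}(g)\le T$. Then $\bar{\mathbb Z}_n$ has bounded sample paths on $\mathcal G$ and converges weakly in $\ell^\infty(\mathcal G)$ to a tight Gaussian limit. -/

import Mathlib

open MeasureTheory ProbabilityTheory Filter Topology
open scoped ENNReal NNReal BoundedContinuousFunction

noncomputable section

namespace EmpCopula

/-! ### The unit cube, generalized volumes, Vitali and Hardy-Krause variation -/

/-- The closed unit cube `[0,1]^ι`. -/
abbrev Cube (ι : Type*) := ι → unitInterval

/-- The generalized volume of the box `(a, b]` under `f`,
`∑_{I ⊆ ι} (-1)^{|I|} f(a_I : b_{-I})`. -/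
def boxVolume {ι : Type*} [Fintype ι] [DecidableEq ι] (f : Cube ι → ℝ) (a b : Cube ι) : ℝ :=
  ∑ I : Finset ι, (-1) ^ I.card * f (I.piecewise a b)

/-- The successor of `y` in a one-dimensional ladder `Y`: the smallest element of `Y` that is
larger than `y`, and `1` if there is none (the infimum of the empty finset in `[0,1]` is `1`). -/
def ladderSucc (Y : Finset unitInterval) (y : unitInterval) : unitInterval :=
  (Y.filter (fun z => y < z)).inf id

/-- The variation of `f` over the multivariate ladder `∏ i, ({0} ∪ Y i)`: the sum over all points
`y` of the ladder of `|Δ_f (y, y⁺]|`. -/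
def ladderVariation {ι : Type*} [Fintype ι] [DecidableEq ι] (f : Cube ι → ℝ)
    (Y : ι → Finset unitInterval) : ℝ :=
  ∑ y ∈ Fintype.piFinset (fun i => insert 0 (Y i)),
    |boxVolume f y (fun i => ladderSucc (Y i) (y i))|

/-- Total variation in the sense of Vitali: the supremum of the variation over all multivariate
ladders, given by arbitrary finite subsets `Y i` of `(0,1)`. If `ι` is empty, this is `|f|` at the
only point of the cube. -/
def vitaliVariation {ι : Type*} [Fintype ι] [DecidableEq ι] (f : Cube ι → ℝ) : ℝ≥0∞ :=
  ⨆ (Y : ι → Finset unitInterval) (_ : ∀ i, ∀ z ∈ Y i, 0 < z ∧ z < 1),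
    ENNReal.ofReal (ladderVariation f Y)

/-- The lower-dimensional projection `f(· ; 1_{-I})` on `[0,1]^I`. -/
def upperFace {ι : Type*} [DecidableEq ι] (f : Cube ι → ℝ) (I : Finset ι) : Cube I → ℝ :=
  fun x => f (fun i => if h : i ∈ I then x ⟨i, h⟩ else 1)

/-- Total variation in the sense of Hardy-Krause, including the term `|f(1)|` of `I = ∅`. -/
def hkVariation {ι : Type*} [Fintype ι] [DecidableEq ι] (f : Cube ι → ℝ) : ℝ≥0∞ :=
  ∑ I : Finset ι, vitaliVariation (upperFace f I)

/-- Right-continuity in each coordinate, at every point of the cube. -/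
def CoordRightContinuous {ι : Type*} [DecidableEq ι] (f : Cube ι → ℝ) : Prop :=
  ∀ (x : Cube ι) (j : ι),
    ContinuousWithinAt (fun t => f (Function.update x j t)) (Set.Ici (x j)) (x j)

/-! ### Weak convergence in `ℓ^∞(T)` -/

/-- The Banach space of bounded real functions on `T` with the supremum norm. -/
abbrev EllInfty (T : Type*) := lp (fun _ : T => ℝ) ∞

instance (T : Type*) : MeasurableSpace (EllInfty T) := borel _

instance (T : Type*) : BorelSpace (EllInfty T) := ⟨rfl⟩

/-- The outer expectation `E^* Z` of a bounded, not necessarily measurable, `Z : Ω → ℝ`. -/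
def outerExpectation {Ω : Type*} [MeasurableSpace Ω] (P : Measure Ω) (Z : Ω → ℝ) : ℝ :=
  sInf {r : ℝ | ∃ U : Ω → ℝ, Measurable U ∧ Integrable U P ∧ (∀ ω, Z ω ≤ U ω) ∧ r = ∫ ω, U ω ∂P}

/-- Weak convergence in `ℓ^∞(T)` (in the sense of Hoffmann-Jørgensen) of the processes
`X n = (X n · t)_{t ∈ T}` with bounded paths to a random element with Borel law `μ`:
`E^* h(X n) → ∫ h dμ` for every bounded continuous `h : ℓ^∞(T) → ℝ`. -/
def ConvergesWeakly {Ω T : Type*} [MeasurableSpace Ω] (P : Measure Ω) (X : ℕ → Ω → T → ℝ)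
    (μ : Measure (EllInfty T)) : Prop :=
  ∃ hX : ∀ n ω, Memℓp (X n ω) ∞, ∀ h : EllInfty T →ᵇ ℝ,
    Tendsto (fun n => outerExpectation P (fun ω => h ⟨X n ω, hX n ω⟩)) atTop (𝓝 (∫ x, h x ∂μ))

/-- `μ` is the law of a Gaussian process in `ℓ^∞(T)`: a Borel probability measure all of whose
finite-dimensional marginals are (possibly degenerate) normal distributions. -/
structure IsGaussianLaw {T : Type*} (μ : Measure (EllInfty T)) : Prop where
  isProbabilityMeasure : IsProbabilityMeasure μ
  isGaussianProcess : IsGaussianProcess (fun (t : T) (x : EllInfty T) => x t) μ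

/-! ### Empirical copula processes -/

/-- The `j`-th marginal distribution function `F_j` of the law `F` on `ℝ^d`, with values in
`[0,1]`. -/
def marginalCDF {d : ℕ} (F : Measure (Fin d → ℝ)) (j : Fin d) (t : ℝ) : unitInterval :=
  ⟨cdf (F.map (fun x => x j)) t, cdf_nonneg _ _, cdf_le_one _ _⟩

/-- The map `x ↦ (F_1(x_1), …, F_d(x_d))`. -/
def marginalTransform {d : ℕ} (F : Measure (Fin d → ℝ)) (x : Fin d → ℝ) : Cube (Fin d) :=
  fun j => marginalCDF F j (x j)

/-- The copula `C` of a law `F` on `ℝ^d` with continuous marginals: the distribution function of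
`(F_1(X_1), …, F_d(X_d))` for `X ∼ F`. -/
def copula {d : ℕ} (F : Measure (Fin d → ℝ)) (u : Cube (Fin d)) : ℝ :=
  F.real {x | marginalTransform F x ≤ u}

/-- The empirical distribution function `t ↦ n⁻¹ #{k < n : y_k ≤ t}`, with values in `[0,1]`. -/
def empiricalCDF (n : ℕ) (y : ℕ → ℝ) (t : ℝ) : unitInterval :=
  ⟨((Finset.range n).filter (fun k => y k ≤ t)).card / n, by positivity,
    div_le_one_of_le₀
      (by exact_mod_cast (Finset.card_filter_le _ _).trans (Finset.card_range n).le)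
      (by positivity)⟩

/-- The rank vector `(𝔽_{n1}(x_{i1}), …, 𝔽_{nd}(x_{id}))` of the `i`-th observation among the
first `n`. -/
def rankVector {d : ℕ} (n : ℕ) (x : ℕ → Fin d → ℝ) (i : ℕ) : Cube (Fin d) :=
  fun j => empiricalCDF n (fun k => x k j) (x i j)

/-- The càdlàg empirical copula function
`u ↦ n⁻¹ ∑_{i < n} 1{𝔽_{n1}(x_{i1}) ≤ u_1, …, 𝔽_{nd}(x_{id}) ≤ u_d}`. -/
def empiricalCopula {d : ℕ} (n : ℕ) (x : ℕ → Fin d → ℝ) (u : Cube (Fin d)) : ℝ :=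
  (1 / n) * ∑ i ∈ Finset.range n, (Set.Iic u).indicator 1 (rankVector n x i)

/-- The empirical copula process `√n (C̄_n - C)`, indexed by points of the cube. -/
def empiricalCopulaProcess {Ω : Type*} {d : ℕ} (F : Measure (Fin d → ℝ))
    (X : ℕ → Ω → Fin d → ℝ) (n : ℕ) (ω : Ω) (u : Cube (Fin d)) : ℝ :=
  √n * (empiricalCopula n (fun i => X i ω) u - copula F u)

/-- The empirical copula process `g ↦ √n ∫ g d(C̄_n - C)` indexed by functions, that is
`n^{-1/2} ∑_{i < n} {g(𝔽_{n1}(X_{i1}), …, 𝔽_{nd}(X_{id})) - E[g(F_1(X_{i1}), …, F_d(X_{id}))]}`. -/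
def indexedCopulaProcess {Ω : Type*} [MeasurableSpace Ω] (P : Measure Ω) {d : ℕ}
    (F : Measure (Fin d → ℝ)) (X : ℕ → Ω → Fin d → ℝ) (𝒢 : Set (Cube (Fin d) → ℝ))
    (n : ℕ) (ω : Ω) (g : 𝒢) : ℝ :=
  (1 / √n) * ∑ i ∈ Finset.range n,
    ((g : Cube (Fin d) → ℝ) (rankVector n (fun k => X k ω) i) -
      ∫ ω', (g : Cube (Fin d) → ℝ) (marginalTransform F (X i ω')) ∂P)

end EmpCopula

end

/-!
The integral of `g` against the difference of the empirical copula and the copula is a continuous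
linear function of the difference of the two distribution functions, so that the theorem is an
instance of the continuous mapping theorem.

The analytic core is a bound in the spirit of the Koksma-Hlawka inequality: if `g` is
right-continuous in each coordinate with Hardy-Krause variation at most `T`, then the integral of
`g` against any finite signed combination of probability measures on the cube is at most `T` times
the supremum norm of the distribution function of the combination
(`measurable_and_abs_le_and_abs_integral_le`). If the arguments of `g` are first rounded up to a
grid, then `g` is a combination of indicators of lower orthants whose coefficients are, up to sign,
generalized volumes of the cells of the grid (`comp_gridCeil_eq_sum`), and the bound is immediate.
The bound survives pointwise limits, and the grids are refined one coordinate after the other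
(`CoordRightContinuous.of_comp_gridCeil`).

By the Hahn-Banach theorem, integration of all members of `𝒢` therefore extends to one continuous
linear map `Γ : ℓ^∞([0,1]^d) → ℓ^∞(𝒢)` of norm at most `T` (`exists_integration_clm`), which maps
the empirical copula process exactly to the process indexed by `𝒢`. Hence weak convergence passes
through `Γ` (`ConvergesWeakly.map`), and the limit is the image under `Γ` of the given limit `μ`.

Since `μ` is carried by the continuous functions on the cube, which form a Polish space, its image
is tight (`isTightMeasureSet_map_of_ae_continuous`). It is Gaussian since on continuous functions
each continuous linear functional on `ℓ^∞` is a limit of linear combinations of finitely many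
evaluations (`exists_tendsto_sum_mul_of_continuous`), and almost sure limits of Gaussian random
variables are Gaussian (`hasGaussianLaw_of_ae_tendsto`).
-/

noncomputable section

namespace EmpCopula

/-! ### Almost sure limits of Gaussian random variables -/

/-- The mean of a normal law lies in every compact interval `[-B, B]` that carries more than half
of the mass, since the law is symmetric about its mean. -/
lemma abs_le_of_gaussianReal_compl_lt {m : ℝ} {v : ℝ≥0} {B : ℝ}
    (h : gaussianReal m v (Set.Icc (-B) B)ᶜ < 1 / 2) : |m| ≤ B := by
  set γ := gaussianReal m v with hγ
  have hsymm : γ (Set.Ici m) = γ (Set.Iic m) := by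
    have h1 : γ.map (fun x => 2 * m - x) = γ := by
      rw [hγ, gaussianReal_map_const_sub]; congr 1; ring
    conv_lhs => rw [← h1]
    rw [Measure.map_apply (by fun_prop) measurableSet_Ici]
    congr 1
    ext x
    simp only [Set.mem_preimage, Set.mem_Ici, Set.mem_Iic]
    constructor <;> intro <;> linarith
  have htot : (1 : ℝ≥0∞) ≤ γ (Set.Iic m) + γ (Set.Iic m) := by
    calc (1 : ℝ≥0∞) = γ (Set.Ici m ∪ Set.Iic m) := by
          rw [Set.union_comm, Set.Iic_union_Ici, measure_univ]
      _ ≤ γ (Set.Ici m) + γ (Set.Iic m) := measure_union_le _ _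
      _ = _ := by rw [hsymm]
  have hhalf : (1 / 2 : ℝ≥0∞) ≤ γ (Set.Iic m) := by
    rw [← two_mul] at htot
    exact ENNReal.div_le_of_le_mul' htot
  by_contra hm
  rw [abs_le, not_and_or, not_le, not_le] at hm
  refine absurd h (not_lt.2 ?_)
  rcases hm with hm | hm
  · refine hhalf.trans (measure_mono fun x hx hxB => ?_)
    exact absurd (hxB.1.trans hx) (not_le.2 hm)
  · refine (hhalf.trans hsymm.ge).trans (measure_mono fun x hx hxB => ?_)
    exact absurd (le_trans (Set.mem_Ici.1 hx) hxB.2) (not_le.2 hm)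

/-- If the characteristic functions of normal laws converge pointwise to that of a probability
measure, then the variances are eventually bounded, since the limit is close to `1` near the
origin. -/
lemma exists_variance_le_of_tendsto_charFun {ν : Measure ℝ} [IsProbabilityMeasure ν]
    {m : ℕ → ℝ} {v : ℕ → ℝ≥0}
    (h : ∀ t, Tendsto (fun k => charFun (gaussianReal (m k) (v k)) t) atTop (𝓝 (charFun ν t))) :
    ∃ B, ∀ᶠ k in atTop, (v k : ℝ) ≤ B := by
  have h0 : ∀ᶠ t in 𝓝 (0 : ℝ), 1 / 2 < ‖charFun ν t‖ := by
    have hc : ContinuousAt (fun t => ‖charFun ν t‖) 0 := continuous_charFun.norm.continuousAt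
    refine hc.eventually_const_lt ?_
    simp only [charFun_zero, probReal_univ]
    norm_num
  obtain ⟨ε, hε, hball⟩ := Metric.eventually_nhds_iff.1 h0
  have ht := @hball (ε / 2) (by rw [dist_zero_right, Real.norm_of_nonneg] <;> linarith)
  refine ⟨2 / (ε / 2) ^ 2, ?_⟩
  filter_upwards [(h (ε / 2)).norm.eventually_const_lt ht] with k hk
  rw [charFun_gaussianReal, Complex.norm_exp] at hk
  have hre : ((((ε / 2 : ℝ) : ℂ) * (m k : ℂ) * Complex.I
      - ((v k : ℝ) : ℂ) * ((ε / 2 : ℝ) : ℂ) ^ 2 / 2)).re = -((v k : ℝ) * (ε / 2) ^ 2 / 2) := by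
    rw [← Complex.ofReal_pow, ← Complex.ofReal_mul, ← Complex.ofReal_mul,
      Complex.sub_re, Complex.re_ofReal_mul, Complex.I_re, mul_zero, zero_sub, neg_inj]
    norm_cast
  rw [hre, Real.exp_neg] at hk
  have h1 := Real.add_one_le_exp ((v k : ℝ) * (ε / 2) ^ 2 / 2)
  have h2 : Real.exp ((v k : ℝ) * (ε / 2) ^ 2 / 2) < 2 := by
    rw [one_div] at hk
    exact (inv_lt_inv₀ (by norm_num) (Real.exp_pos _)).1 hk
  rw [le_div_iff₀ (by positivity)]
  linarith

/-- If the characteristic functions of normal laws converge pointwise to that of a probability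
measure, then the means are bounded, by tightness. -/
lemma exists_abs_mean_le_of_tendsto_charFun {ν : Measure ℝ} [IsProbabilityMeasure ν]
    {m : ℕ → ℝ} {v : ℕ → ℝ≥0}
    (h : ∀ t, Tendsto (fun k => charFun (gaussianReal (m k) (v k)) t) atTop (𝓝 (charFun ν t))) :
    ∃ B, ∀ k, |m k| ≤ B := by
  have htight := isTightMeasureSet_of_tendsto_charFun continuous_charFun.continuousAt h
  obtain ⟨K, hK, hKle⟩ := isTightMeasureSet_iff_exists_isCompact_measure_compl_le.1 htight
    (1 / 4) (by norm_num)
  obtain ⟨B, hB⟩ := hK.isBounded.subset_closedBall 0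
  refine ⟨B, fun k => abs_le_of_gaussianReal_compl_lt (v := v k) ?_⟩
  refine lt_of_le_of_lt ((measure_mono ?_).trans (hKle _ ⟨k, rfl⟩)) ?_
  · rw [Set.compl_subset_compl, ← Real.closedBall_zero_eq_Icc]
    exact hB
  · exact ENNReal.div_lt_div_left (by simp) (by simp) (by norm_num)

/-- A pointwise limit of characteristic functions of normal laws belongs to a normal law, if it is
the characteristic function of a probability measure at all. -/
lemma exists_eq_gaussianReal_of_tendsto_charFun {ν : Measure ℝ} [IsProbabilityMeasure ν]
    {m : ℕ → ℝ} {v : ℕ → ℝ≥0}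
    (h : ∀ t, Tendsto (fun k => charFun (gaussianReal (m k) (v k)) t) atTop (𝓝 (charFun ν t))) :
    ∃ a b, ν = gaussianReal a b := by
  obtain ⟨B, hB⟩ := exists_abs_mean_le_of_tendsto_charFun h
  obtain ⟨B', hB'⟩ := exists_variance_le_of_tendsto_charFun h
  have hcomp : IsCompact (Set.Icc (-B) B ×ˢ Set.Icc 0 B') := isCompact_Icc.prod isCompact_Icc
  obtain ⟨⟨a, b⟩, hab, φ, hφ, hlim⟩ := hcomp.tendsto_subseq' (x := fun k => (m k, (v k : ℝ)))
    (Eventually.frequently (hB'.mono fun k hk => ⟨abs_le.1 (hB k), (v k).2, hk⟩))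
  lift b to ℝ≥0 using hab.2.1
  refine ⟨a, b, Measure.ext_of_charFun (funext fun t => ?_)⟩
  refine tendsto_nhds_unique ((h t).comp hφ.tendsto_atTop) ?_
  have hcont : Continuous fun p : ℝ × ℝ =>
      Complex.exp (t * p.1 * Complex.I - p.2 * t ^ 2 / 2) := by fun_prop
  have hcomp := (hcont.tendsto (a, (b : ℝ))).comp hlim
  rw [charFun_gaussianReal]
  refine hcomp.congr fun k => ?_
  simp only [Function.comp_apply, charFun_gaussianReal]

/-- An almost sure limit of real Gaussian random variables is Gaussian. -/
lemma hasGaussianLaw_of_ae_tendsto {Ω : Type*} [MeasurableSpace Ω] {P : Measure Ω}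
    [IsProbabilityMeasure P] {Y : ℕ → Ω → ℝ} {Z : Ω → ℝ} (hY : ∀ k, HasGaussianLaw (Y k) P)
    (hZ : AEMeasurable Z P) (h : ∀ᵐ ω ∂P, Tendsto (fun k => Y k ω) atTop (𝓝 (Z ω))) :
    HasGaussianLaw Z P := by
  have hprob : IsProbabilityMeasure (P.map Z) := Measure.isProbabilityMeasure_map hZ
  have hd := tendstoInDistribution_of_ae_tendsto (fun k => (hY k).aemeasurable) hZ h
  have hchar : ∀ t, Tendsto (fun k => charFun (P.map (Y k)) t) atTop (𝓝 (charFun (P.map Z) t)) :=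
    ProbabilityMeasure.tendsto_iff_tendsto_charFun.1 hd.tendsto
  simp_rw [fun k => (hY k).map_eq_gaussianReal] at hchar
  obtain ⟨a, b, hab⟩ := exists_eq_gaussianReal_of_tendsto_charFun hchar
  refine ⟨?_⟩
  rw [hab]
  infer_instance

/-! ### Rounding up to a grid -/

/-- Rounding up to the grid `{0} ∪ Y ∪ {1}`: the smallest grid point that is at least `x`. -/
def gridCeil (Y : Finset unitInterval) (x : unitInterval) : unitInterval :=
  ((insert 0 Y).filter (fun y => x ≤ y)).inf id

lemma le_gridCeil (Y : Finset unitInterval) (x : unitInterval) : x ≤ gridCeil Y x :=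
  Finset.le_inf fun _ hy => (Finset.mem_filter.1 hy).2

lemma gridCeil_le {Y : Finset unitInterval} {x y : unitInterval} (hy : y ∈ Y) (hxy : x ≤ y) :
    gridCeil Y x ≤ y :=
  Finset.inf_le (f := id) (Finset.mem_filter.2 ⟨Finset.mem_insert_of_mem hy, hxy⟩)

/-- The finite set of those among the first `k` terms of a dense sequence of `[0,1]` that lie in
`(0,1)`. -/
def denseGrid (k : ℕ) : Finset unitInterval :=
  ((Finset.range k).image (TopologicalSpace.denseSeq unitInterval)).filter
    (fun z => 0 < z ∧ z < 1)

lemma tendsto_gridCeil_denseGrid (x : unitInterval) :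
    Tendsto (fun k => gridCeil (denseGrid k) x) atTop (𝓝 x) := by
  refine tendsto_order.2 ⟨fun a ha => Eventually.of_forall fun k => ha.trans_le (le_gridCeil _ _),
    fun b hb => ?_⟩
  obtain ⟨n, hz⟩ := (TopologicalSpace.denseRange_denseSeq unitInterval).exists_mem_open
    isOpen_Ioo (Set.nonempty_Ioo.2 hb)
  filter_upwards [eventually_gt_atTop n] with k hk
  refine (gridCeil_le ?_ hz.1.le).trans_lt hz.2
  refine Finset.mem_filter.2 ⟨Finset.mem_image_of_mem _ (Finset.mem_range.2 hk), ?_, ?_⟩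
  · exact (unitInterval.nonneg' : (0 : unitInterval) ≤ x).trans_lt hz.1
  · exact hz.2.trans_le unitInterval.le_one'

/-- Telescoping over a finite set, in which the last point is followed by `1`, the infimum of the
empty set. -/
lemma sum_filter_lt_inf_sub (S : Finset unitInterval) (h : unitInterval → ℝ) :
    ∑ y ∈ S, (h ((S.filter (fun z => y < z)).inf id) - h y) = h 1 - h (S.inf id) := by
  induction S using Finset.induction_on_min with
  | empty => exact (sub_self (h 1)).symm
  | insert a S ha ih =>
    have haS : a ∉ S := fun h => lt_irrefl _ (ha a h)
    rw [Finset.sum_insert haS]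
    have h1 : (insert a S).filter (fun z => a < z) = S := by
      rw [Finset.filter_insert, if_neg (lt_irrefl a), Finset.filter_true_of_mem ha]
    have h2 : ∀ y ∈ S, (insert a S).filter (fun z => y < z) = S.filter (fun z => y < z) := by
      intro y hy
      rw [Finset.filter_insert, if_neg (ha y hy).not_gt]
    have h3 : (insert a S).inf id = a := by
      rw [Finset.inf_insert, id, inf_eq_left]
      exact Finset.le_inf fun y hy => (ha y hy).le
    rw [Finset.sum_congr rfl fun y hy => by rw [h2 y hy], ih, h1, h3]
    ring

lemma sum_ladderSucc_sub (Y : Finset unitInterval) (x : unitInterval) (h : unitInterval → ℝ) :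
    ∑ y ∈ (insert 0 Y).filter (fun y => x ≤ y), (h (ladderSucc Y y) - h y)
      = h 1 - h (gridCeil Y x) := by
  rw [gridCeil, ← sum_filter_lt_inf_sub]
  refine Finset.sum_congr rfl fun y hy => ?_
  have : ((insert 0 Y).filter (fun y => x ≤ y)).filter (fun z => y < z)
      = Y.filter (fun z => y < z) := by
    ext z
    simp only [Finset.mem_filter, Finset.mem_insert]
    constructor
    · rintro ⟨⟨rfl | hz, -⟩, hyz⟩
      · exact absurd hyz unitInterval.nonneg'.not_gt
      · exact ⟨hz, hyz⟩
    · exact fun ⟨hz, hyz⟩ => ⟨⟨Or.inr hz, (Finset.mem_filter.1 hy).2.trans hyz.le⟩, hyz⟩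
  rw [this, ladderSucc]

/-! ### Summation by parts on a grid -/

section
variable {ι : Type*} [DecidableEq ι]

/-- The point of the cube with coordinates `y` in the directions of `I` and `1` elsewhere. -/
def extendOne (I : Finset ι) (y : Cube I) : Cube ι :=
  fun i => if h : i ∈ I then y ⟨i, h⟩ else 1

lemma extendOne_restrict_piecewise (I : Finset ι) (J : Finset I) (v : Cube ι) :
    extendOne I (J.piecewise (fun i => v i) 1)
      = (J.map (Function.Embedding.subtype _)).piecewise v 1 := by
  ext i
  by_cases hi : i ∈ I
  · by_cases hJ : (⟨i, hi⟩ : I) ∈ J <;> simp [extendOne, hi, hJ, Finset.piecewise]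
  · simp [extendOne, hi, Finset.piecewise]

lemma boxVolume_upperFace_one (g : Cube ι → ℝ) (I : Finset ι) (v : Cube ι) :
    boxVolume (upperFace g I) (fun i => v i) 1
      = ∑ J ∈ I.powerset, (-1) ^ J.card * g (J.piecewise v 1) := by
  rw [boxVolume]
  refine Finset.sum_nbij' (fun J => J.map (Function.Embedding.subtype _))
    (fun K => K.subtype (· ∈ I)) ?_ ?_ ?_ ?_ ?_
  · intro J _
    rw [Finset.mem_powerset]
    intro i hi
    obtain ⟨j, -, rfl⟩ := Finset.mem_map.1 hi
    exact j.2
  · exact fun _ _ => Finset.mem_univ _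
  · intro J _
    ext i
    simp
  · intro K hK
    exact Finset.subtype_map_of_mem fun i hi => Finset.mem_powerset.1 hK hi
  · intro J _
    rw [Finset.card_map, ← extendOne_restrict_piecewise]
    rfl

variable [Fintype ι]

/-- The generalized volume is a tensor product of one-dimensional increments. -/
lemma boxVolume_eq_sum_prod (f : Cube ι → ℝ) (Q : ι → Finset unitInterval) {a b : Cube ι}
    (ha : ∀ j, a j ∈ Q j) (hb : ∀ j, b j ∈ Q j) :
    boxVolume f a b = ∑ q ∈ Fintype.piFinset Q,
      (∏ j, ((if b j = q j then 1 else 0) - (if a j = q j then (1 : ℝ) else 0))) * f q := by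
  have hprod (q : Cube ι) :
      ∏ j, ((if b j = q j then 1 else 0) - (if a j = q j then (1 : ℝ) else 0))
        = ∑ I : Finset ι, (-1) ^ I.card * (if I.piecewise a b = q then 1 else 0) := by
    rw [Finset.prod_sub, Finset.powerset_univ]
    refine Finset.sum_congr rfl fun I _ => ?_
    rw [mul_assoc]
    congr 1
    rw [Finset.prod_ite_zero, Finset.prod_ite_zero, Finset.prod_const_one, Finset.prod_const_one,
      ite_zero_mul_ite_zero, one_mul]
    refine ite_cond_congr (propext ?_)
    rw [funext_iff]
    constructor
    · rintro ⟨h1, h2⟩ j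
      by_cases hj : j ∈ I
      · rw [Finset.piecewise_eq_of_mem _ _ _ hj, h2 j hj]
      · rw [Finset.piecewise_eq_of_notMem _ _ _ hj, h1 j (by simpa using hj)]
    · refine fun h => ⟨fun j hj => ?_, fun j hj => ?_⟩
      · rw [← h j, Finset.piecewise_eq_of_notMem _ _ _ (by simpa using hj)]
      · rw [← h j, Finset.piecewise_eq_of_mem _ _ _ hj]
  simp_rw [hprod, Finset.sum_mul]
  rw [Finset.sum_comm, boxVolume]
  refine Finset.sum_congr rfl fun I _ => ?_
  have hmem : I.piecewise a b ∈ Fintype.piFinset Q := by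
    refine Fintype.mem_piFinset.2 fun j => ?_
    by_cases hj : j ∈ I
    · rw [Finset.piecewise_eq_of_mem _ _ _ hj]; exact ha j
    · rw [Finset.piecewise_eq_of_notMem _ _ _ hj]; exact hb j
  simp_rw [mul_assoc, ite_mul, one_mul, zero_mul, ← Finset.mul_sum]
  rw [Finset.sum_ite_eq, if_pos hmem]

/-- Additivity of the generalized volume: if in each coordinate the increments over the points of
`S j` telescope to the increment from `a j` to `b j`, then the volumes of the product cells sum up
to the volume of the box from `a` to `b`. -/
lemma sum_boxVolume_eq (f : Cube ι → ℝ) (S : ι → Finset unitInterval)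
    (s : ι → unitInterval → unitInterval) (a b : Cube ι)
    (h : ∀ (j : ι) (φ : unitInterval → ℝ), ∑ y ∈ S j, (φ (s j y) - φ y) = φ (b j) - φ (a j)) :
    ∑ y ∈ Fintype.piFinset S, boxVolume f y (fun j => s j (y j)) = boxVolume f a b := by
  set Q : ι → Finset unitInterval := fun j => S j ∪ (S j).image (s j) ∪ {a j, b j} with hQ
  rw [boxVolume_eq_sum_prod f Q (by simp [hQ]) (by simp [hQ])]
  have h1 : ∀ y ∈ Fintype.piFinset S, boxVolume f y (fun j => s j (y j))
      = ∑ q ∈ Fintype.piFinset Q, (∏ j, ((if s j (y j) = q j then 1 else 0)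
        - (if y j = q j then (1 : ℝ) else 0))) * f q := by
    intro y hy
    have hy' := Fintype.mem_piFinset.1 hy
    exact boxVolume_eq_sum_prod f Q (fun j => by simp [hQ, hy' j])
      (fun j => Finset.mem_union_left _ (Finset.mem_union_right _
        (Finset.mem_image_of_mem _ (hy' j))))
  rw [Finset.sum_congr rfl h1, Finset.sum_comm]
  refine Finset.sum_congr rfl fun q _ => ?_
  rw [← Finset.sum_mul, ← Finset.prod_univ_sum S
    (fun j y => (if s j y = q j then 1 else 0) - (if y = q j then (1 : ℝ) else 0))]
  congr 1
  exact Finset.prod_congr rfl fun j _ => h j (fun z => if z = q j then 1 else 0)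

lemma sum_superset_neg_one_pow_card (J : Finset ι) :
    ∑ I : Finset ι, (if J ⊆ I then (-1 : ℝ) ^ I.card else 0)
      = if J = Finset.univ then (-1) ^ J.card else 0 := by
  have h := Finset.prod_add (fun _ : ι => (-1 : ℝ)) (fun i => if i ∈ J then 0 else 1) Finset.univ
  rw [Finset.powerset_univ] at h
  have h1 : ∀ I : Finset ι, (∏ _i ∈ I, (-1 : ℝ)) *
      ∏ i ∈ Finset.univ \ I, (if i ∈ J then (0 : ℝ) else 1)
      = if J ⊆ I then (-1 : ℝ) ^ I.card else 0 := by
    intro I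
    rw [Finset.prod_const]
    split_ifs with hJI
    · rw [Finset.prod_eq_one, mul_one]
      intro i hi
      rw [if_neg fun hiJ => (Finset.mem_sdiff.1 hi).2 (hJI hiJ)]
    · obtain ⟨i, hiJ, hiI⟩ := Finset.not_subset.1 hJI
      rw [Finset.prod_eq_zero (i := i) (by simpa using hiI) (by simp [hiJ]), mul_zero]
  rw [Finset.sum_congr rfl fun I _ => h1 I] at h
  rw [← h]
  split_ifs with hJ
  · subst hJ
    simp
  · obtain ⟨i, hi⟩ : ∃ i, i ∉ J := by
      by_contra! hall
      exact hJ (Finset.eq_univ_of_forall hall)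
    exact Finset.prod_eq_zero (Finset.mem_univ i) (by simp [hi])

/-- Inclusion-exclusion: a function is recovered from the volumes of the boxes with upper corner
`1` under its lower-dimensional projections. -/
lemma eq_sum_boxVolume_upperFace (g : Cube ι → ℝ) (v : Cube ι) :
    g v = ∑ I : Finset ι, (-1) ^ I.card * boxVolume (upperFace g I) (fun i => v i) 1 := by
  simp_rw [boxVolume_upperFace_one, Finset.mul_sum]
  have h1 : ∀ I : Finset ι, ∑ J ∈ I.powerset, (-1 : ℝ) ^ I.card * ((-1) ^ J.card *
      g (J.piecewise v 1)) = ∑ J : Finset ι, (if J ⊆ I then (-1 : ℝ) ^ I.card else 0) *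
        ((-1) ^ J.card * g (J.piecewise v 1)) := by
    intro I
    simp_rw [ite_mul, zero_mul]
    rw [← Finset.sum_filter]
    refine Finset.sum_congr ?_ fun _ _ => rfl
    ext J
    simp
  rw [Finset.sum_congr rfl fun I _ => h1 I, Finset.sum_comm]
  -- Only the term in which all coordinates are those of `v` survives.
  simp_rw [← Finset.sum_mul, sum_superset_neg_one_pow_card, ite_mul, zero_mul]
  rw [Finset.sum_ite_eq' Finset.univ Finset.univ, if_pos (Finset.mem_univ _), ← mul_assoc,
    ← mul_pow]
  simp

/-- Rounding the arguments of `g` up to a grid turns `g` into a combination of indicators of lower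
orthants whose coefficients are, up to sign, the generalized volumes of the cells of the grid. -/
lemma comp_gridCeil_eq_sum (g : Cube ι → ℝ) (Y : ι → Finset unitInterval) (x : Cube ι) :
    g (fun j => gridCeil (Y j) (x j)) = ∑ I : Finset ι,
      ∑ y ∈ Fintype.piFinset (fun i : I => insert 0 (Y i)), (-1) ^ I.card *
        boxVolume (upperFace g I) y (fun i => ladderSucc (Y i) (y i)) *
          (Set.Iic (extendOne I y)).indicator 1 x := by
  rw [eq_sum_boxVolume_upperFace g]
  refine Finset.sum_congr rfl fun I _ => ?_
  simp_rw [mul_assoc, ← Finset.mul_sum]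
  congr 1
  rw [← sum_boxVolume_eq (upperFace g I)
    (fun i : I => (insert 0 (Y i)).filter (fun y => x i ≤ y)) (fun i => ladderSucc (Y i))
    (fun i => gridCeil (Y i) (x i)) 1 (fun i φ => sum_ladderSucc_sub (Y i) (x i) φ)]
  have hset : Fintype.piFinset (fun i : I => (insert 0 (Y i)).filter (fun y => x i ≤ y))
      = (Fintype.piFinset (fun i : I => insert 0 (Y i))).filter (fun y => ∀ i : I, x i ≤ y i) := by
    ext y
    simp [Fintype.mem_piFinset, forall_and]
  rw [hset, Finset.sum_filter]
  refine Finset.sum_congr rfl fun y _ => ?_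
  have hiff : x ∈ Set.Iic (extendOne I y) ↔ ∀ i : I, x i ≤ y i := by
    rw [Set.mem_Iic, Pi.le_def]
    constructor
    · intro h i
      have := h i
      rwa [extendOne, dif_pos i.2] at this
    · intro h i
      by_cases hi : i ∈ I
      · rw [extendOne, dif_pos hi]; exact h ⟨i, hi⟩
      · rw [extendOne, dif_neg hi]; exact unitInterval.le_one'
  by_cases hx : ∀ i : I, x i ≤ y i
  · rw [if_pos hx, Set.indicator_of_mem (hiff.2 hx), Pi.one_apply, mul_one]
  · rw [if_neg hx, Set.indicator_of_notMem (fun h => hx (hiff.1 h)), mul_zero]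

/-- On each grid, the total mass of the cells of all lower-dimensional projections is at most the
Hardy-Krause variation. -/
lemma sum_ladderVariation_le {g : Cube ι → ℝ} {T : ℝ≥0} (hg : hkVariation g ≤ T)
    {Y : ι → Finset unitInterval} (hY : ∀ i, ∀ z ∈ Y i, 0 < z ∧ z < 1) :
    ∑ I : Finset ι, ladderVariation (upperFace g I) (fun i : I => Y i) ≤ T := by
  have hnn : ∀ I : Finset ι, 0 ≤ ladderVariation (upperFace g I) (fun i : I => Y i) :=
    fun I => Finset.sum_nonneg fun _ _ => abs_nonneg _
  have h1 : ENNReal.ofReal (∑ I : Finset ι, ladderVariation (upperFace g I) (fun i : I => Y i))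
      ≤ T := by
    rw [ENNReal.ofReal_sum_of_nonneg fun I _ => hnn I]
    refine le_trans (Finset.sum_le_sum fun I _ => ?_) hg
    exact le_iSup₂_of_le (fun i : I => Y i) (fun i => hY i) le_rfl
  rw [← ENNReal.ofReal_coe_nnreal] at h1
  exact (ENNReal.ofReal_le_ofReal_iff T.2).1 h1

/-- A function of Hardy-Krause variation at most `T`, with arguments rounded up to a grid, is a
combination of indicators of lower orthants with coefficients of total absolute value at most
`T`. -/
lemma exists_comp_gridCeil_eq_sum {g : Cube ι → ℝ} {T : ℝ≥0} (hg : hkVariation g ≤ T)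
    {Y : ι → Finset unitInterval} (hY : ∀ i, ∀ z ∈ Y i, 0 < z ∧ z < 1) :
    ∃ (s : Finset (Σ I : Finset ι, Cube I)) (c : (Σ I : Finset ι, Cube I) → ℝ)
      (p : (Σ I : Finset ι, Cube I) → Cube ι),
      (∀ x : Cube ι, g (fun j => gridCeil (Y j) (x j))
        = ∑ k ∈ s, c k * (Set.Iic (p k)).indicator 1 x) ∧ ∑ k ∈ s, |c k| ≤ T := by
  refine ⟨Finset.univ.sigma fun I => Fintype.piFinset (fun i : I => insert 0 (Y i)),
    fun k => (-1) ^ k.1.card * boxVolume (upperFace g k.1) k.2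
      (fun i => ladderSucc (Y i) (k.2 i)), fun k => extendOne k.1 k.2, fun x => ?_, ?_⟩
  · rw [comp_gridCeil_eq_sum g Y x, Finset.sum_sigma]
  · refine le_trans (le_of_eq ?_) (sum_ladderVariation_le hg hY)
    rw [Finset.sum_sigma]
    simp only [abs_mul, abs_pow, abs_neg, abs_one, one_pow, one_mul]
    rfl

end

/-! ### Integrals of functions of bounded Hardy-Krause variation -/

section
variable {ι : Type*} [Fintype ι] [DecidableEq ι]

/-- A property that is stable under pointwise limits of sequences and holds whenever the arguments
of `g` are rounded up to grids, holds for `g` itself. The grids are refined one coordinate at a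
time, so that right-continuity in each coordinate suffices and joint right-continuity is not
needed. -/
lemma CoordRightContinuous.of_comp_gridCeil {g : Cube ι → ℝ} (hg : CoordRightContinuous g)
    {Q : (Cube ι → ℝ) → Prop}
    (hlim : ∀ (f : ℕ → Cube ι → ℝ) (f' : Cube ι → ℝ), (∀ m, Q (f m)) →
      (∀ x, Tendsto (fun m => f m x) atTop (𝓝 (f' x))) → Q f')
    (hgrid : ∀ k : ι → ℕ, Q (fun x => g (fun j => gridCeil (denseGrid (k j)) (x j)))) : Q g := by
  have key : ∀ (S : Finset ι) (k : ι → ℕ),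
      Q (fun x => g (S.piecewise x (fun j => gridCeil (denseGrid (k j)) (x j)))) := by
    intro S
    induction S using Finset.induction_on with
    | empty => simpa only [Finset.piecewise_empty] using hgrid
    | insert j S hj ih =>
      intro k
      refine hlim _ _ (fun m => ih (Function.update k j m)) fun x => ?_
      set v : Cube ι := (insert j S).piecewise x (fun i => gridCeil (denseGrid (k i)) (x i))
      have hvj : v j = x j := Finset.piecewise_eq_of_mem _ _ _ (Finset.mem_insert_self j S)
      have heq (m : ℕ) : S.piecewise x
          (fun i => gridCeil (denseGrid (Function.update k j m i)) (x i))
          = Function.update v j (gridCeil (denseGrid m) (x j)) := by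
        ext i : 1
        by_cases hi : i = j
        · subst hi
          rw [Finset.piecewise_eq_of_notMem _ _ _ hj, Function.update_self, Function.update_self]
        · by_cases hiS : i ∈ S <;> simp [v, Finset.piecewise, hi, hiS]
      -- Only the `j`-th coordinate moves, and it tends to `x j` from the right.
      simp_rw [heq]
      have h := hg v j
      rw [ContinuousWithinAt, Function.update_eq_self, hvj] at h
      exact h.comp (tendsto_nhdsWithin_iff.2
        ⟨tendsto_gridCeil_denseGrid (x j), Eventually.of_forall fun m => le_gridCeil _ _⟩)
  simpa only [Finset.piecewise_univ] using key Finset.univ 0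

lemma zero_lt_and_lt_one_of_mem_denseGrid {k : ℕ} {z : unitInterval} (hz : z ∈ denseGrid k) :
    0 < z ∧ z < 1 :=
  (Finset.mem_filter.1 hz).2

/-- The quantitative form of integration by parts: the integral of `g` against a finite signed
combination of probability measures is at most the Hardy-Krause variation of `g` times the supremum
norm of the distribution function of the combination. In addition, `g` is measurable and bounded,
so that the integrals exist. -/
lemma measurable_and_abs_le_and_abs_integral_le {g : Cube ι → ℝ} {T : ℝ≥0}
    (hg : CoordRightContinuous g) (hgT : hkVariation g ≤ T)
    (a : ProbabilityMeasure (Cube ι) →₀ ℝ) {N : ℝ}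
    (hN : ∀ u, |∑ m ∈ a.support, a m * (m : Measure (Cube ι)).real (Set.Iic u)| ≤ N) :
    Measurable g ∧ (∀ x, |g x| ≤ T) ∧ |∑ m ∈ a.support, a m * ∫ x, g x ∂m| ≤ T * N := by
  refine hg.of_comp_gridCeil (Q := fun f => Measurable f ∧ (∀ x, |f x| ≤ T) ∧
    |∑ m ∈ a.support, a m * ∫ x, f x ∂m| ≤ T * N) ?_ ?_
  · intro f f' hf hlim
    have hmeas : Measurable f' :=
      measurable_of_tendsto_metrizable (fun m => (hf m).1) (tendsto_pi_nhds.2 hlim)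
    refine ⟨hmeas, fun x => le_of_tendsto' (hlim x).abs fun m => (hf m).2.1 x, ?_⟩
    refine le_of_tendsto' (x := atTop)
      (Tendsto.abs (tendsto_finsetSum _ fun m _ => Tendsto.const_mul _ ?_)) fun k => (hf k).2.2
    exact tendsto_integral_of_dominated_convergence (fun _ => (T : ℝ))
      (fun k => (hf k).1.aestronglyMeasurable) (integrable_const _)
      (fun k => Eventually.of_forall fun x => (hf k).2.1 x) (Eventually.of_forall hlim)
  · intro k
    obtain ⟨s, c, p, hrep, hc⟩ := exists_comp_gridCeil_eq_sum hgT
      (fun i z hz => zero_lt_and_lt_one_of_mem_denseGrid (k := k i) hz)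
    have hN0 : 0 ≤ N := (abs_nonneg _).trans (hN 0)
    simp_rw [hrep]
    refine ⟨?_, fun x => ?_, ?_⟩
    · exact Finset.measurable_sum _ fun i _ =>
        (measurable_one.indicator measurableSet_Iic).const_mul _
    · refine (Finset.abs_sum_le_sum_abs _ _).trans ((Finset.sum_le_sum fun i _ => ?_).trans hc)
      rw [abs_mul]
      refine mul_le_of_le_one_right (abs_nonneg _) ?_
      by_cases hx : x ∈ Set.Iic (p i) <;> simp [hx]
    · have hint (m : ProbabilityMeasure (Cube ι)) :
          ∫ x, ∑ i ∈ s, c i * (Set.Iic (p i)).indicator 1 x ∂(m : Measure (Cube ι))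
            = ∑ i ∈ s, c i * (m : Measure (Cube ι)).real (Set.Iic (p i)) := by
        rw [integral_finsetSum _ fun i _ => Integrable.const_mul
          (f := (Set.Iic (p i)).indicator 1)
          ((integrable_const (1 : ℝ)).indicator measurableSet_Iic) (c i)]
        refine Finset.sum_congr rfl fun i _ => ?_
        rw [integral_const_mul, integral_indicator_one measurableSet_Iic]
      simp_rw [hint, Finset.mul_sum]
      rw [Finset.sum_comm]
      calc |∑ i ∈ s, ∑ m ∈ a.support, a m * (c i * (m : Measure (Cube ι)).real (Set.Iic (p i)))|
          ≤ ∑ i ∈ s, |c i| * N := by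
            refine (Finset.abs_sum_le_sum_abs _ _).trans (Finset.sum_le_sum fun i _ => ?_)
            simp_rw [mul_left_comm _ (c i)]
            rw [← Finset.mul_sum, abs_mul]
            exact mul_le_mul_of_nonneg_left (hN (p i)) (abs_nonneg _)
        _ ≤ T * N := by
            rw [← Finset.sum_mul]
            exact mul_le_mul_of_nonneg_right hc hN0

lemma CoordRightContinuous.measurable {g : Cube ι → ℝ} {T : ℝ≥0}
    (hg : CoordRightContinuous g) (hgT : hkVariation g ≤ T) : Measurable g :=
  (measurable_and_abs_le_and_abs_integral_le hg hgT 0 (N := 0) (by simp)).1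

end

/-! ### The integral as a bounded functional of the distribution function -/

section
variable {ι : Type*}

/-- The distribution function of a probability measure on the cube, as an element of
`ℓ^∞([0,1]^ι)`. -/
def distributionFunction (m : ProbabilityMeasure (Cube ι)) : EllInfty (Cube ι) :=
  ⟨fun u => (m : Measure (Cube ι)).real (Set.Iic u), memℓp_infty ⟨1, by
    rintro _ ⟨u, rfl⟩
    exact (Real.norm_of_nonneg measureReal_nonneg).trans_le measureReal_le_one⟩⟩

lemma linearCombination_distributionFunction_apply (a : ProbabilityMeasure (Cube ι) →₀ ℝ)
    (u : Cube ι) : Finsupp.linearCombination ℝ distributionFunction a u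
      = Finsupp.linearCombination ℝ
          (fun m : ProbabilityMeasure (Cube ι) => (m : Measure (Cube ι)).real (Set.Iic u)) a :=
  Finsupp.apply_linearCombination ℝ (lp.evalₗ (𝕜 := ℝ) (fun _ : Cube ι => ℝ) ∞ u) distributionFunction a

/-- A linear functional that is dominated by the norm of a linear map factors through it as a
continuous linear functional, by the Hahn-Banach theorem. -/
lemma exists_strongDual_comp_eq {V E : Type*} [AddCommGroup V] [Module ℝ V]
    [NormedAddCommGroup E] [NormedSpace ℝ E] (A : V →ₗ[ℝ] E) (B : V →ₗ[ℝ] ℝ) {T : ℝ≥0}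
    (h : ∀ v, |B v| ≤ T * ‖A v‖) :
    ∃ Φ : StrongDual ℝ E, (∀ z, |Φ z| ≤ T * ‖z‖) ∧ ∀ v, Φ (A v) = B v := by
  obtain ⟨s, hs⟩ := A.rangeRestrict.exists_rightInverse_of_surjective A.range_rangeRestrict
  have hAs (y : LinearMap.range A) : A (s y) = y :=
    congrArg Subtype.val (LinearMap.congr_fun hs y)
  obtain ⟨Φ, hΦ, hnorm⟩ := exists_extension_norm_eq (LinearMap.range A)
    ((B ∘ₗ s).mkContinuous T fun y => by
      have := h (s y)
      rwa [hAs] at this)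
  refine ⟨Φ, fun z => ?_, fun v => ?_⟩
  · refine Φ.le_of_opNorm_le ?_ z
    rw [hnorm]
    exact LinearMap.mkContinuous_norm_le _ T.2 _
  · have h1 := hΦ ⟨A v, v, rfl⟩
    -- `B` vanishes on the kernel of `A`, so the choice of the section `s` does not matter.
    have h2 := h (s ⟨A v, v, rfl⟩ - v)
    rw [map_sub A, hAs, sub_self, norm_zero, mul_zero] at h2
    rw [map_sub] at h2
    exact h1.trans (sub_eq_zero.1 (abs_nonpos_iff.1 h2))

variable [Fintype ι] [DecidableEq ι]

/-- For a class `𝒢` of uniformly bounded Hardy-Krause variation, integration over `𝒢` is a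
continuous linear map of the distribution function, from `ℓ^∞([0,1]^ι)` to `ℓ^∞(𝒢)`. -/
lemma exists_integration_clm {𝒢 : Set (Cube ι → ℝ)} {T : ℝ≥0}
    (h𝒢 : ∀ g ∈ 𝒢, CoordRightContinuous g ∧ hkVariation g ≤ T) :
    ∃ Γ : EllInfty (Cube ι) →L[ℝ] EllInfty 𝒢, ∀ (a : ProbabilityMeasure (Cube ι) →₀ ℝ) (g : 𝒢),
      Γ (Finsupp.linearCombination ℝ distributionFunction a) g
        = Finsupp.linearCombination ℝ (fun m : ProbabilityMeasure (Cube ι) =>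
            ∫ x, (g : Cube ι → ℝ) x ∂(m : Measure (Cube ι))) a := by
  have hex (g : 𝒢) := exists_strongDual_comp_eq (T := T)
    (Finsupp.linearCombination ℝ (distributionFunction (ι := ι)))
    (Finsupp.linearCombination ℝ (fun m : ProbabilityMeasure (Cube ι) =>
      ∫ x, (g : Cube ι → ℝ) x ∂(m : Measure (Cube ι)))) (fun a => by
        refine (measurable_and_abs_le_and_abs_integral_le (h𝒢 g g.2).1 (h𝒢 g g.2).2 a
          fun u => ?_).2.2
        have := lp.norm_apply_le_norm ENNReal.top_ne_zero
          (Finsupp.linearCombination ℝ (distributionFunction (ι := ι)) a) u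
        rwa [linearCombination_distributionFunction_apply] at this)
  choose Φ hΦ hΦA using hex
  have hmem (z : EllInfty (Cube ι)) : Memℓp (fun g : 𝒢 => Φ g z) ∞ :=
    memℓp_infty ⟨T * ‖z‖, by rintro _ ⟨g, rfl⟩; exact hΦ g z⟩
  let Γ₀ : EllInfty (Cube ι) →ₗ[ℝ] EllInfty 𝒢 :=
    { toFun := fun z => ⟨fun g => Φ g z, hmem z⟩
      map_add' := fun z w => by ext g; exact map_add (Φ g) z w
      map_smul' := fun r z => by ext g; exact map_smul (Φ g) r z }
  exact ⟨Γ₀.mkContinuous T fun z => lp.norm_le_of_forall_le (by positivity) fun g => hΦ g z,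
    fun a g => hΦA g a⟩

end

/-! ### Laws on `ℓ^∞` that are carried by the continuous functions -/

section
variable {S : Type*} [PseudoMetricSpace S] [CompactSpace S]

/-- Continuous linear functionals of a continuous function are limits of linear combinations of
finitely many values of the function: compose the function with maps of finite range that tend
uniformly to the identity. -/
lemma exists_tendsto_sum_mul_of_continuous (L : StrongDual ℝ (EllInfty S)) :
    ∃ (t : ℕ → Finset S) (c : ℕ → S → ℝ), ∀ z : EllInfty S, Continuous (fun u => z u) →
      Tendsto (fun k => ∑ p ∈ t k, c k p * z p) atTop (𝓝 (L z)) := by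
  classical
  have hex (k : ℕ) : ∃ (t : Finset S) (f : S → S), ∀ x, f x ∈ t ∧ dist (f x) x < 1 / (k + 1) := by
    obtain ⟨t, -, ht, hcover⟩ := (isCompact_univ (X := S)).finite_cover_balls
      (e := 1 / (k + 1)) (by positivity)
    have : ∀ x : S, ∃ y ∈ t, dist y x < 1 / (k + 1) := fun x => by
      obtain ⟨y, hy, hxy⟩ := Set.mem_iUnion₂.1 (hcover (Set.mem_univ x))
      exact ⟨y, hy, by rwa [dist_comm]⟩
    choose f hf using this
    exact ⟨ht.toFinset, f, fun x => ⟨ht.mem_toFinset.2 (hf x).1, (hf x).2⟩⟩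
  choose t f hf using hex
  let e (k : ℕ) (p : S) : EllInfty S := ⟨fun x => if f k x = p then 1 else 0,
    memℓp_infty ⟨1, by rintro _ ⟨x, rfl⟩; dsimp only; split_ifs <;> simp⟩⟩
  refine ⟨t, fun k p => L (e k p), fun z hz => ?_⟩
  have happly (k : ℕ) (x : S) : (∑ p ∈ t k, z p • e k p) x = z (f k x) := by
    have h1 := map_sum (lp.evalₗ (𝕜 := ℝ) (fun _ : S => ℝ) ∞ x) (fun p => z p • e k p) (t k)
    refine h1.trans ?_
    have h2 : ∀ p ∈ t k, lp.evalₗ (𝕜 := ℝ) (fun _ : S => ℝ) ∞ x (z p • e k p)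
        = if f k x = p then z p else 0 := fun p _ => by
      rw [map_smul]
      change z p * (if f k x = p then 1 else 0) = _
      rw [mul_ite, mul_one, mul_zero]
    rw [Finset.sum_congr rfl h2, Finset.sum_ite_eq, if_pos (hf k x).1]
  have hL (k : ℕ) : ∑ p ∈ t k, L (e k p) * z p = L (∑ p ∈ t k, z p • e k p) := by
    rw [map_sum]
    refine Finset.sum_congr rfl fun p _ => ?_
    rw [map_smul, smul_eq_mul, mul_comm]
  simp_rw [hL]
  refine (L.continuous.tendsto z).comp (Metric.tendsto_atTop.2 fun ε hε => ?_)
  obtain ⟨δ, hδ, hunif⟩ := Metric.uniformContinuous_iff.1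
    (CompactSpace.uniformContinuous_of_continuous hz) (ε / 2) (half_pos hε)
  obtain ⟨K, hK⟩ := exists_nat_one_div_lt hδ
  refine ⟨K, fun k hk => ?_⟩
  rw [dist_eq_norm]
  refine lt_of_le_of_lt (lp.norm_le_of_forall_le (half_pos hε).le fun x => ?_) (half_lt_self hε)
  rw [lp.coeFn_sub, Pi.sub_apply, happly]
  refine (hunif ((hf k x).2.trans (lt_of_le_of_lt ?_ hK))).le
  exact one_div_le_one_div_of_le (by positivity) (by gcongr)

/-- A Gaussian process with almost surely continuous paths on a compact space is a Gaussian element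
of `ℓ^∞`: all continuous linear functionals, not only the evaluations, are normal. -/
lemma IsGaussianLaw.isGaussian {μ : Measure (EllInfty S)} (hμ : IsGaussianLaw μ)
    (hcont : ∀ᵐ z ∂μ, Continuous (fun u : S => z u)) : IsGaussian μ := by
  have := hμ.isProbabilityMeasure
  refine isGaussian_of_isGaussian_map fun L => ?_
  obtain ⟨t, c, htc⟩ := exists_tendsto_sum_mul_of_continuous L
  refine (hasGaussianLaw_of_ae_tendsto (Y := fun k z => ∑ p ∈ t k, c k p * z p) (fun k => ?_)
    L.continuous.measurable.aemeasurable (hcont.mono fun z hz => htc z hz)).isGaussian_map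
  have h := (hμ.isGaussianProcess.hasGaussianLaw (t k)).map_fun
    (∑ p : t k, c k p • ContinuousLinearMap.proj (R := ℝ) (φ := fun _ : t k => ℝ) p)
  refine h.congr (Eventually.of_forall fun z => ?_)
  simp only [sum_apply, smul_apply,
    ContinuousLinearMap.proj_apply, smul_eq_mul, Finset.restrict]
  exact Finset.sum_coe_sort (t k) (fun p => c k p * z p)

/-- The isometric inclusion of the continuous functions on a compact space into `ℓ^∞`. -/
def continuousMapToEllInfty (f : C(S, ℝ)) : EllInfty S :=
  ⟨fun u => f u, memℓp_infty ⟨‖f‖, by rintro _ ⟨x, rfl⟩; exact f.norm_coe_le_norm x⟩⟩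

lemma isometry_continuousMapToEllInfty : Isometry (continuousMapToEllInfty (S := S)) := by
  refine Isometry.of_dist_eq fun f g => le_antisymm ?_ ?_
  · rw [dist_eq_norm]
    exact lp.norm_le_of_forall_le dist_nonneg
      fun x => (ContinuousMap.dist_apply_le_dist x : dist (f x) (g x) ≤ dist f g)
  · refine (ContinuousMap.dist_le dist_nonneg).2 fun x => ?_
    rw [dist_eq_norm (continuousMapToEllInfty f)]
    exact lp.norm_apply_le_norm ENNReal.top_ne_zero
      (continuousMapToEllInfty f - continuousMapToEllInfty g) x

/-- A law on `ℓ^∞` carried by the continuous functions has tight images under continuous maps, as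
the space of continuous functions is Polish. -/
lemma isTightMeasureSet_map_of_ae_continuous {μ : Measure (EllInfty S)} [IsFiniteMeasure μ]
    (hcont : ∀ᵐ z ∂μ, Continuous (fun u : S => z u)) {E : Type*} [TopologicalSpace E]
    [T2Space E] [MeasurableSpace E] [BorelSpace E] {Γ : EllInfty S → E} (hΓ : Continuous Γ) :
    IsTightMeasureSet {μ.map Γ} := by
  let _ : MeasurableSpace C(S, ℝ) := borel _
  have : BorelSpace C(S, ℝ) := ⟨rfl⟩
  set J := continuousMapToEllInfty (S := S)
  have hJ : Isometry J := isometry_continuousMapToEllInfty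
  have hJe : MeasurableEmbedding J := hJ.isClosedEmbedding.measurableEmbedding
  have hmap : (μ.comap J).map J = μ := by
    rw [hJe.map_comap]
    exact Measure.restrict_eq_self_of_ae_mem (hcont.mono fun z hz => ⟨⟨_, hz⟩, rfl⟩)
  have hfin : IsFiniteMeasure (μ.comap J) := ⟨by
    rw [hJe.comap_apply]; exact measure_lt_top _ _⟩
  have htight := (isTightMeasureSet_singleton (μ := μ.comap J)).map (hΓ.comp hJ.continuous)
  rwa [Set.image_singleton, ← Measure.map_map hΓ.measurable hJe.measurable, hmap] at htight

end

/-! ### Empirical copula processes as distribution functions -/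

section
variable {d : ℕ} {F : Measure (Fin d → ℝ)}

lemma measurable_marginalTransform (hF : ∀ j, Continuous (cdf (F.map (fun x => x j)))) :
    Measurable (marginalTransform F) :=
  measurable_pi_iff.2 fun j => ((hF j).measurable.comp (measurable_pi_apply j)).subtype_mk

/-- The law on the cube whose distribution function is the copula of `F`. -/
def copulaLaw (F : Measure (Fin d → ℝ)) [IsProbabilityMeasure F]
    (hF : ∀ j, Continuous (cdf (F.map (fun x => x j)))) : ProbabilityMeasure (Cube (Fin d)) :=
  ⟨F.map (marginalTransform F),
    Measure.isProbabilityMeasure_map (measurable_marginalTransform hF).aemeasurable⟩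

lemma copulaLaw_real_Iic [IsProbabilityMeasure F]
    (hF : ∀ j, Continuous (cdf (F.map (fun x => x j)))) (u : Cube (Fin d)) :
    (copulaLaw F hF : Measure (Cube (Fin d))).real (Set.Iic u) = copula F u :=
  map_measureReal_apply (measurable_marginalTransform hF) measurableSet_Iic

/-- The signed combination `√n (n⁻¹ ∑_{i < n} δ_{R_i} - C)` of probability measures, where the `R_i`
are the rank vectors of the observations `x_i` and `C` is the law of the copula. It is `0` if
`n = 0`, in agreement with the processes. -/
def empiricalCombination (F : Measure (Fin d → ℝ)) [IsProbabilityMeasure F]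
    (hF : ∀ j, Continuous (cdf (F.map (fun x => x j)))) (n : ℕ) (x : ℕ → Fin d → ℝ) :
    ProbabilityMeasure (Cube (Fin d)) →₀ ℝ :=
  (1 / √n) • ∑ i ∈ Finset.range n,
    (Finsupp.single (diracProba (rankVector n x i)) 1 - Finsupp.single (copulaLaw F hF) 1)

lemma linearCombination_empiricalCombination [IsProbabilityMeasure F]
    (hF : ∀ j, Continuous (cdf (F.map (fun x => x j)))) (n : ℕ) (x : ℕ → Fin d → ℝ)
    (φ : ProbabilityMeasure (Cube (Fin d)) → ℝ) :
    Finsupp.linearCombination ℝ φ (empiricalCombination F hF n x)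
      = (1 / √n) * ∑ i ∈ Finset.range n,
        (φ (diracProba (rankVector n x i)) - φ (copulaLaw F hF)) := by
  simp only [empiricalCombination, map_smul, map_sum, map_sub, Finsupp.linearCombination_single,
    one_mul, smul_eq_mul]

variable {Ω : Type*} {X : ℕ → Ω → Fin d → ℝ} [IsProbabilityMeasure F]

lemma empiricalCopulaProcess_eq (hF : ∀ j, Continuous (cdf (F.map (fun x => x j)))) (n : ℕ)
    (ω : Ω) (u : Cube (Fin d)) : empiricalCopulaProcess F X n ω u
      = Finsupp.linearCombination ℝ distributionFunction
          (empiricalCombination F hF n (fun i => X i ω)) u := by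
  have hdirac (i : ℕ) : (Measure.dirac (rankVector n (fun i => X i ω) i)).real (Set.Iic u)
      = (Set.Iic u).indicator 1 (rankVector n (fun i => X i ω) i) := by
    rw [measureReal_def, Measure.dirac_apply' _ measurableSet_Iic]
    by_cases h : rankVector n (fun i => X i ω) i ∈ Set.Iic u
    · rw [Set.indicator_of_mem h, Set.indicator_of_mem h]; simp
    · rw [Set.indicator_of_notMem h, Set.indicator_of_notMem h]; simp
  rw [linearCombination_distributionFunction_apply, linearCombination_empiricalCombination,
    empiricalCopulaProcess, empiricalCopula]
  simp only [diracProba, ProbabilityMeasure.coe_mk, hdirac, copulaLaw_real_Iic,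
    Finset.sum_sub_distrib, Finset.sum_const, Finset.card_range, nsmul_eq_mul]
  rcases Nat.eq_zero_or_pos n with rfl | hn
  · simp
  · have h1 : (0 : ℝ) < n := by exact_mod_cast hn
    have h2 : √(n : ℝ) ≠ 0 := (Real.sqrt_pos.2 h1).ne'
    field_simp
    rw [Real.sq_sqrt h1.le]

lemma indexedCopulaProcess_eq [MeasurableSpace Ω] {P : Measure Ω}
    (hF : ∀ j, Continuous (cdf (F.map (fun x => x j))))
    (hX : ∀ i, HasLaw (X i) F P) {𝒢 : Set (Cube (Fin d) → ℝ)} (h𝒢 : ∀ g ∈ 𝒢, Measurable g)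
    (n : ℕ) (ω : Ω) (g : 𝒢) : indexedCopulaProcess P F X 𝒢 n ω g
      = Finsupp.linearCombination ℝ (fun m : ProbabilityMeasure (Cube (Fin d)) =>
          ∫ x, (g : Cube (Fin d) → ℝ) x ∂(m : Measure (Cube (Fin d))))
          (empiricalCombination F hF n (fun i => X i ω)) := by
  have hg := (h𝒢 g g.2).stronglyMeasurable
  rw [linearCombination_empiricalCombination, indexedCopulaProcess]
  congr 1
  refine Finset.sum_congr rfl fun i _ => ?_
  congr 1
  · exact (integral_dirac' _ _ hg).symm
  · have hT := measurable_marginalTransform hF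
    calc ∫ ω', (g : Cube (Fin d) → ℝ) (marginalTransform F (X i ω')) ∂P
        = ∫ x, (g : Cube (Fin d) → ℝ) (marginalTransform F x) ∂(P.map (X i)) :=
          (integral_map (hX i).aemeasurable
            (hg.comp_measurable hT).aestronglyMeasurable).symm
      _ = ∫ x, (g : Cube (Fin d) → ℝ) (marginalTransform F x) ∂F := by rw [(hX i).map_eq]
      _ = _ := (integral_map hT.aemeasurable hg.aestronglyMeasurable).symm

end

/-! ### Weak convergence under continuous linear maps -/

/-- The continuous mapping theorem for processes that are images of one another. -/
lemma ConvergesWeakly.map {Ω S T : Type*} [MeasurableSpace Ω] {P : Measure Ω} {X : ℕ → Ω → S → ℝ}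
    {Y : ℕ → Ω → T → ℝ} {μ : Measure (EllInfty S)} (hX : ConvergesWeakly P X μ)
    {Γ : EllInfty S → EllInfty T} (hΓ : Continuous Γ)
    (hY : ∀ n ω (z : EllInfty S), (z : S → ℝ) = X n ω → (Γ z : T → ℝ) = Y n ω) :
    ConvergesWeakly P Y (μ.map Γ) := by
  obtain ⟨hmem, hlim⟩ := hX
  have heq (n : ℕ) (ω : Ω) := hY n ω ⟨X n ω, hmem n ω⟩ rfl
  refine ⟨fun n ω => heq n ω ▸ lp.memℓp _, fun h => ?_⟩
  rw [integral_map hΓ.measurable.aemeasurable h.continuous.measurable.aestronglyMeasurable]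
  refine (hlim (h.compContinuous ⟨Γ, hΓ⟩)).congr fun n => ?_
  congr 1
  funext ω
  exact congrArg h (Subtype.ext (heq n ω))

lemma IsGaussianLaw.of_isGaussian {T : Type*} {ν : Measure (EllInfty T)} [IsGaussian ν] :
    IsGaussianLaw ν where
  isProbabilityMeasure := inferInstance
  isGaussianProcess := ⟨fun I => ⟨isGaussian_map (ContinuousLinearMap.pi
    fun t : I => lp.evalCLM ℝ (fun _ : T => ℝ) ∞ t)⟩⟩

end EmpCopula

end

theorem mainTheorem4 {Ω : Type*} [MeasurableSpace Ω] (P : Measure Ω) [IsProbabilityMeasure P]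
    {d : ℕ} (F : Measure (Fin d → ℝ)) [IsProbabilityMeasure F]
    (hF : ∀ j, Continuous (cdf (F.map (fun x => x j))))
    (X : ℕ → Ω → Fin d → ℝ) (hX : ∀ i, HasLaw (X i) F P)
    (hconv : ∃ μ : Measure (EmpCopula.EllInfty (EmpCopula.Cube (Fin d))),
      EmpCopula.IsGaussianLaw μ ∧
      (∀ᵐ x ∂μ, Continuous (fun u : EmpCopula.Cube (Fin d) => x u)) ∧
      EmpCopula.ConvergesWeakly P (EmpCopula.empiricalCopulaProcess F X) μ)
    (𝒢 : Set (EmpCopula.Cube (Fin d) → ℝ)) (T : ℝ≥0)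
    (h𝒢 : ∀ g ∈ 𝒢, EmpCopula.CoordRightContinuous g ∧ EmpCopula.hkVariation g ≤ T) :
    ∃ ν : Measure (EmpCopula.EllInfty 𝒢),
      EmpCopula.IsGaussianLaw ν ∧ IsTightMeasureSet {ν} ∧
      EmpCopula.ConvergesWeakly P (EmpCopula.indexedCopulaProcess P F X 𝒢) ν := by
  obtain ⟨μ, hμ, hcont, hweak⟩ := hconv
  obtain ⟨Γ, hΓ⟩ := EmpCopula.exists_integration_clm h𝒢
  have := hμ.isProbabilityMeasure
  have := hμ.isGaussian hcont
  refine ⟨μ.map Γ, EmpCopula.IsGaussianLaw.of_isGaussian,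
    EmpCopula.isTightMeasureSet_map_of_ae_continuous hcont Γ.continuous,
    hweak.map Γ.continuous fun n ω z hz => ?_⟩
  have hz' : z = Finsupp.linearCombination ℝ EmpCopula.distributionFunction
      (EmpCopula.empiricalCombination F hF n (fun i => X i ω)) := by
    ext u
    rw [hz, EmpCopula.empiricalCopulaProcess_eq hF]
  ext g
  rw [hz', hΓ, EmpCopula.indexedCopulaProcess_eq hF hX
    fun g hg => (h𝒢 g hg).1.measurable (h𝒢 g hg).2]
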